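/- Let $\mathbb{B}^*$ be the set of finite binary strings. A \emph{(conditional) prefix machine} is a partial computable function $M:\mathbb{B}^*\times\mathbb{B}^*\rightharpoonup\mathbb{B}^*$ such that for every $y$ the set $\{p: M(p,y)\text{ is defined}\}$ is prefix-free. A prefix machine $U$ is \emph{optimal} if for every prefix machine $M$ there is a constant $k$ such that whenever $M(p,y)=x$ there is $q$ with $U(q,y)=x$ and $\ell(q)\le\ell(p)+k$, where $\ell$ denotes length. Fix an optimal prefix machine $U$, let $K(x|y):=\min\{\ell(p):U(p,y)=x\}$, and for a constant $c\ge 0$ let $d_K(x,y):=\max\{K(x|y),K(y|x)\}+c$ for $x\ne y$ and $d_K(x,x):=0$. (For all sufficiently large $c$, $d_K$ is a metric on $\mathbb{B}^*$.) For $p\geq 1$ let $\ell_p$ be the space of real sequences $v=(v_i)_{i\in\mathbb{N}}$ with $\|v\|_p:=(\sum_i|v_i|^p)^{1/p}<\infty$. Let $d_{K_{3,2}}$ be the path metric on the five vertices $V$ of the complete bipartite graph $K_{3,2}$. Then for every optimal prefix machine $U$ and every $c\ge 0$: 1. For every $1\le p\le 2$, $(\mathbb{B}^*,d_K)$ cannot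 be isometrically embedded into $\ell_p$; that is, there is no $f:\mathbb{B}^*\to\ell_p$ with $\|f(x)-f(y)\|_p=d_K(x,y)$ for all $x,y\in\mathbb{B}^*$. In particular it cannot be isometrically embedded into $\ell_1$ or $\ell_2$. 2. $K_{3,2}$ scale-embeds into $(\mathbb{B}^*,d_K)$: there are maps $\phi_s:V\to\mathbb{B}^*$ ($s=1,2,\dots$) and constants $a,b$ such that $|d_K(\phi_s(v),\phi_s(v'))-s\cdot d_{K_{3,2}}(v,v')|\le a\log_2 s+b$ for all $s\ge 1$ and all $v,v'\in V$. 3. For every $1\le p\le 2$, $(V,d_{K_{3,2}})$ cannot be isometrically embedded into $\ell_p$. -/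

import Mathlib

/-- A conditional prefix machine: a partial computable function `M p y` of a binary program `p`
and a binary side input `y` whose set of halting programs is prefix-free for every fixed `y`. -/
structure IsPrefixMachine (M : List Bool → List Bool →. List Bool) : Prop where
  partrec : Partrec₂ M
  prefixFree : ∀ y p q : List Bool, (M p y).Dom → (M q y).Dom → p <+: q → p = q

/-- An optimal (universal) reference prefix machine: a prefix machine that simulates every prefix
machine with a constant overhead in program length. -/
structure IsOptimalPrefixMachine (U : List Bool → List Bool →. List Bool) : Prop where
  isPrefixMachine : IsPrefixMachine U
  optimal : ∀ M : List Bool → List Bool →. List Bool, IsPrefixMachine M →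
    ∃ k : ℕ, ∀ p x y : List Bool, x ∈ M p y → ∃ q : List Bool, x ∈ U q y ∧ q.length ≤ p.length + k

/-- Conditional prefix Kolmogorov complexity `K(x|y)` with respect to `U`: the length of a shortest
program that computes `x` from `y`. -/
noncomputable def condK (U : List Bool → List Bool →. List Bool) (x y : List Bool) : ℕ :=
  sInf {n : ℕ | ∃ p : List Bool, x ∈ U p y ∧ p.length = n}

/-- For an optimal machine the set in `condK` is never empty. -/
theorem IsOptimalPrefixMachine.exists_program {U : List Bool → List Bool →. List Bool}
    (hU : IsOptimalPrefixMachine U) (x y : List Bool) :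
    ∃ p : List Bool, x ∈ U p y ∧ p.length = condK U x y := by
  have hM : IsPrefixMachine
      (fun p _ => ((bif decide (p = []) then some x else none : Option (List Bool)) :
        Part (List Bool))) := by
    constructor
    · have h : Computable fun a : List Bool × List Bool =>
          (bif decide (a.1 = []) then some x else none : Option (List Bool)) := by
        refine Computable.cond ?_ (Computable.const _) (Computable.const _)
        have h0 : PrimrecPred fun a : List Bool × List Bool => a.1 = [] :=
          Primrec.eq.comp Primrec.fst (Primrec.const [])
        exact h0.decide.to_comp
      exact h.ofOption
    · intro y p q hp hq _
      by_cases h1 : p = []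
      · by_cases h2 : q = []
        · rw [h1, h2]
        · simp [h2] at hq
      · simp [h1] at hp
  obtain ⟨k, hk⟩ := hU.optimal _ hM
  obtain ⟨q, hq, _⟩ := hk [] x y (by simp)
  exact Nat.sInf_mem (s := {n : ℕ | ∃ p : List Bool, x ∈ U p y ∧ p.length = n}) ⟨_, q, hq, rfl⟩

/-- The complexity distance `d_K(x,y) = max {K(x|y), K(y|x)} + c` for `x ≠ y`, `d_K(x,x) = 0`. -/
noncomputable def dK (U : List Bool → List Bool →. List Bool) (c : ℝ) (x y : List Bool) : ℝ :=
  if x = y then 0 else max (condK U x y : ℝ) (condK U y x : ℝ) + c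

/-- The set `X` with distance `d` embeds isometrically into the real sequence space `ℓ_p`. -/
def IsoEmbedsIntoLp {X : Type*} (d : X → X → ℝ) (p : ENNReal) : Prop :=
  ∃ f : X → lp (fun _ : ℕ => ℝ) p, ∀ x y : X, ‖f x - f y‖ = d x y

/-- The family `φ s : V → {0,1}^*`, `s = 1, 2, …`, is a scale-embedding of `V` with distance `d`
into the binary strings with distance `D`: `D (φ s v) (φ s v') = s · d v v' ± O(log s)`,
uniformly in `v`, `v'`. -/
def IsScaleEmbedding {V : Type*} (d : V → V → ℝ) (D : List Bool → List Bool → ℝ)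
    (φ : ℕ → V → List Bool) : Prop :=
  ∃ a b : ℝ, ∀ s : ℕ, 1 ≤ s → ∀ v v' : V,
    |D (φ s v) (φ s v') - s * d v v'| ≤ a * Real.logb 2 s + b

/-- The path metric of the complete bipartite graph `K_{3,2}`. -/
noncomputable def distK32 (v w : Fin 3 ⊕ Fin 2) : ℝ :=
  ((completeBipartiteGraph (Fin 3) (Fin 2)).dist v w : ℝ)

/-! Take a `2 × 2` matrix of random blocks of `s` bits. The two rows are the vertices on one side of
`K_{3,2}`; the two columns and their xor are the three on the other. Two vertices on the same side
determine the whole matrix, hence are independent: distance about `2s`. A row and a column share one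
block, and a row and the xor column share the xor of the row's entries: distance about `s`. Explicit
programs (`exists_upperBound`) and counting (`exists_incompressible`) make this precise up to a
constant.

An isometry of `d_K` into `ℓ_p`, divided by `s`, would place five points at distances arbitrarily
close to those of `K_{3,2}`. `exists_lp_far_from_distK32` excludes this with a fixed margin. For `p
= 1` the pentagonal inequality fails on `K_{3,2}`: the sides are `8` and `6`. For `1 < p < ∞`
uniform convexity makes approximate midpoints nearly unique, while both rows are midpoints of the
first two columns and lie at distance `2`. This second argument needs only a 4-cycle; the third
column serves `ℓ_1`, where a 4-cycle embeds. -/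

/-! ### Upper bounds on conditional complexity -/

/-- If the length of the program is a computable function of the length of the side input, then
running programs through a total computable function is a prefix machine. -/
theorem isPrefixMachine_of_length {F : List Bool → List Bool → List Bool} {g : ℕ → ℕ}
    (hF : Computable₂ F) (hg : Computable g) :
    IsPrefixMachine fun p y =>
      ((bif decide (p.length = g y.length) then some (F p y) else none : Option (List Bool)) :
        Part (List Bool)) := by
  constructor
  · have h : Computable fun a : List Bool × List Bool =>
        (bif decide (a.1.length = g a.2.length) then some (F a.1 a.2) else none :
          Option (List Bool)) := by
      refine Computable.cond ?_ (Computable.option_some.comp hF) (Computable.const _)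
      have h0 : PrimrecPred fun a : ℕ × ℕ => a.1 = a.2 := Primrec.eq
      exact h0.decide.to_comp.comp ((Computable.list_length.comp Computable.fst).pair
        (hg.comp (Computable.list_length.comp Computable.snd)))
    exact h.ofOption
  · intro y p q hp hq hpq
    have key : ∀ r : List Bool, ((bif decide (r.length = g y.length) then some (F r y)
        else none : Option (List Bool)) : Part (List Bool)).Dom → r.length = g y.length := by
      intro r hr
      by_contra h
      simp [h] at hr
    exact hpq.eq_of_length ((key p hp).trans (key q hq).symm)

theorem condK_le_of_mem {U : List Bool → List Bool →. List Bool} {x y p : List Bool}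
    (h : x ∈ U p y) : condK U x y ≤ p.length :=
  Nat.sInf_le ⟨p, h, rfl⟩

/-- The side input fixes the program length, so no self-delimiting code is needed and the overhead
is constant instead of logarithmic. -/
theorem IsOptimalPrefixMachine.condK_le {U : List Bool → List Bool →. List Bool}
    (hU : IsOptimalPrefixMachine U) {F : List Bool → List Bool → List Bool} {g : ℕ → ℕ}
    (hF : Computable₂ F) (hg : Computable g) :
    ∃ k : ℕ, ∀ p y : List Bool, p.length = g y.length →
      condK U (F p y) y ≤ g y.length + k := by
  obtain ⟨k, hk⟩ := hU.optimal _ (isPrefixMachine_of_length hF hg)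
  refine ⟨k, fun p y h => ?_⟩
  obtain ⟨q, hq, hl⟩ := hk p (F p y) y (by simp [h])
  exact (condK_le_of_mem hq).trans (h ▸ hl)

/-! ### The five strings -/

theorem Primrec.list_zipWith_xor : Primrec₂ (List.zipWith xor) := by
  have h : Primrec fun a : List Bool × List Bool =>
      (List.range (min a.1.length a.2.length)).map
        fun i => xor (a.1.getD i false) (a.2.getD i false) := by
    refine Primrec.list_map (Primrec.list_range.comp (Primrec.nat_min.comp
      (Primrec.list_length.comp Primrec.fst) (Primrec.list_length.comp Primrec.snd))) ?_
    exact (Primrec.dom_bool₂ xor).comp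
      ((Primrec.list_getD false).comp (Primrec.fst.comp Primrec.fst) Primrec.snd)
      ((Primrec.list_getD false).comp (Primrec.snd.comp Primrec.fst) Primrec.snd)
  refine h.of_eq fun a => List.ext_getElem (by simp) fun i h₁ h₂ => ?_
  simp at h₁
  simp [h₁]

/-- The five vertices as pairs of blocks: two lines of one ruling and three of the other ruling of
the quadric of rank one `2 × 2` matrices. -/
def vertexBlocks {s : ℕ} (w : Fin 2 → Fin 2 → Fin s → Bool) :
    Fin 3 ⊕ Fin 2 → (Fin s → Bool) × (Fin s → Bool)
  | .inl 0 => (w 0 0, w 1 0)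
  | .inl 1 => (w 0 1, w 1 1)
  | .inl 2 => (fun i => xor (w 0 0 i) (w 0 1 i), fun i => xor (w 1 0 i) (w 1 1 i))
  | .inr j => (w j 0, w j 1)

/-- The string that represents a vertex. -/
def vertexString {s : ℕ} (w : Fin 2 → Fin 2 → Fin s → Bool) (v : Fin 3 ⊕ Fin 2) : List Bool :=
  List.ofFn (vertexBlocks w v).1 ++ List.ofFn (vertexBlocks w v).2

@[simp] theorem length_vertexString {s : ℕ} (w : Fin 2 → Fin 2 → Fin s → Bool)
    (v : Fin 3 ⊕ Fin 2) : (vertexString w v).length = 2 * s := by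
  simp [vertexString, two_mul]

/-- The distance of `K_{3,2}` with natural number values. -/
def natDistK32 : Fin 3 ⊕ Fin 2 → Fin 3 ⊕ Fin 2 → ℕ
  | .inl i, .inl j => if i = j then 0 else 2
  | .inr i, .inr j => if i = j then 0 else 2
  | .inl _, .inr _ => 1
  | .inr _, .inl _ => 1

theorem distK32_eq (v w : Fin 3 ⊕ Fin 2) : distK32 v w = natDistK32 v w := by
  have two : ∀ x y z : Fin 3 ⊕ Fin 2, x ≠ y → ¬ (completeBipartiteGraph (Fin 3) (Fin 2)).Adj x y →
      (completeBipartiteGraph (Fin 3) (Fin 2)).Adj x z →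
      (completeBipartiteGraph (Fin 3) (Fin 2)).Adj z y →
      (completeBipartiteGraph (Fin 3) (Fin 2)).dist x y = 2 := by
    intro x y z hxy hn h1 h2
    have hle := SimpleGraph.dist_le (SimpleGraph.Walk.cons h1 (SimpleGraph.Walk.cons h2 .nil))
    have h0 := (h1.reachable.trans h2.reachable).dist_eq_zero_iff.not.2 hxy
    have h1' := (SimpleGraph.dist_eq_one_iff_adj).not.2 hn
    simp at hle
    omega
  unfold distK32
  norm_cast
  rcases v with i | i <;> rcases w with j | j <;> simp only [natDistK32]
  · split_ifs with h
    · simp [h]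
    · exact two _ _ (.inr 0) (by simpa using h) (by simp) (by simp) (by simp)
  · exact SimpleGraph.dist_eq_one_iff_adj.2 (by simp)
  · exact SimpleGraph.dist_eq_one_iff_adj.2 (by simp)
  · split_ifs with h
    · simp [h]
    · exact two _ _ (.inl 0) (by simpa using h) (by simp) (by simp) (by simp)

/-- A uniform bound `K(x|y) ≤ s d + k` for the strings of two vertices. -/
def UpperBound (U : List Bool → List Bool →. List Bool) (v v' : Fin 3 ⊕ Fin 2) (d : ℕ) : Prop :=
  ∃ k : ℕ, ∀ (s : ℕ) (w : Fin 2 → Fin 2 → Fin s → Bool),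
    condK U (vertexString w v) (vertexString w v') ≤ s * d + k

theorem upperBound_self {U : List Bool → List Bool →. List Bool}
    (hU : IsOptimalPrefixMachine U) (v : Fin 3 ⊕ Fin 2) : UpperBound U v v 0 := by
  obtain ⟨k, hk⟩ := hU.condK_le (F := fun _ y => y) (g := fun _ => 0) Computable.snd
    (Computable.const _)
  exact ⟨k, fun s w => by simpa using hk [] (vertexString w v) rfl⟩

theorem upperBound_two {U : List Bool → List Bool →. List Bool}
    (hU : IsOptimalPrefixMachine U) (v v' : Fin 3 ⊕ Fin 2) : UpperBound U v v' 2 := by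
  obtain ⟨k, hk⟩ := hU.condK_le (F := fun p _ => p) (g := id) Computable.fst Computable.id
  exact ⟨k, fun s w => by
    simpa [mul_comm] using
      hk (vertexString w v) (vertexString w v') (by simp)⟩

/-- The program is one half of the target; the other half is computed from it and the side input.
Since the side input has length `2 * s`, `n / 2` is the program length. -/
theorem upperBound_append_left {U : List Bool → List Bool →. List Bool}
    (hU : IsOptimalPrefixMachine U) {v v' : Fin 3 ⊕ Fin 2}
    (h : List Bool → List Bool → List Bool)
    (hh : Computable₂ h)
    (e : ∀ (s : ℕ) (w : Fin 2 → Fin 2 → Fin s → Bool), ∃ p : Fin s → Bool,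
      vertexString w v = h (List.ofFn p) (vertexString w v') ++ List.ofFn p) :
    UpperBound U v v' 1 := by
  obtain ⟨k, hk⟩ := hU.condK_le (F := fun p y => h p y ++ p) (g := fun n => n / 2)
    (Computable.list_append.comp hh Computable.fst)
    (Primrec.nat_div.comp Primrec.id (Primrec.const 2)).to_comp
  refine ⟨k, fun s w => ?_⟩
  obtain ⟨p, hp⟩ := e s w
  have := hk (List.ofFn p) (vertexString w v') (by simp)
  rw [← hp] at this
  simpa using this

theorem upperBound_append_right {U : List Bool → List Bool →. List Bool}
    (hU : IsOptimalPrefixMachine U) {v v' : Fin 3 ⊕ Fin 2}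
    (h : List Bool → List Bool → List Bool)
    (hh : Computable₂ h)
    (e : ∀ (s : ℕ) (w : Fin 2 → Fin 2 → Fin s → Bool), ∃ p : Fin s → Bool,
      vertexString w v = List.ofFn p ++ h (List.ofFn p) (vertexString w v')) :
    UpperBound U v v' 1 := by
  obtain ⟨k, hk⟩ := hU.condK_le (F := fun p y => p ++ h p y) (g := fun n => n / 2)
    (Computable.list_append.comp Computable.fst hh)
    (Primrec.nat_div.comp Primrec.id (Primrec.const 2)).to_comp
  refine ⟨k, fun s w => ?_⟩
  obtain ⟨p, hp⟩ := e s w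
  have := hk (List.ofFn p) (vertexString w v') (by simp)
  rw [← hp] at this
  simpa using this

/-- The first half of a string. -/
def firstHalf (y : List Bool) : List Bool := y.take (y.length / 2)

/-- The second half of a string. -/
def secondHalf (y : List Bool) : List Bool := y.drop (y.length / 2)

@[simp] theorem firstHalf_append_ofFn {s : ℕ} (u v : Fin s → Bool) :
    firstHalf (List.ofFn u ++ List.ofFn v) = List.ofFn u := by
  simp [firstHalf, ← two_mul]

@[simp] theorem secondHalf_append_ofFn {s : ℕ} (u v : Fin s → Bool) :
    secondHalf (List.ofFn u ++ List.ofFn v) = List.ofFn v := by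
  simp [secondHalf, ← two_mul]

theorem computable_firstHalf : Computable firstHalf :=
  (Primrec.list_take.comp (Primrec.nat_div.comp Primrec.list_length (Primrec.const 2))
    Primrec.id).to_comp

theorem computable_secondHalf : Computable secondHalf :=
  (Primrec.list_drop.comp (Primrec.nat_div.comp Primrec.list_length (Primrec.const 2))
    Primrec.id).to_comp

theorem zipWith_xor_ofFn {s : ℕ} (u v : Fin s → Bool) :
    List.zipWith xor (List.ofFn u) (List.ofFn v) = List.ofFn fun i => xor (u i) (v i) :=
  List.ext_getElem (by simp) fun i h₁ h₂ => by simp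

theorem computable_zipWith_xor {f g : List Bool × List Bool → List Bool} (hf : Computable f)
    (hg : Computable g) : Computable fun a => List.zipWith xor (f a) (g a) :=
  Primrec.list_zipWith_xor.to_comp.comp hf hg

theorem exists_upperBound {U : List Bool → List Bool →. List Bool}
    (hU : IsOptimalPrefixMachine U) (v v' : Fin 3 ⊕ Fin 2) :
    UpperBound U v v' (natDistK32 v v') := by
  have hfst : Computable₂ fun _ y : List Bool => firstHalf y :=
    computable_firstHalf.comp Computable.snd
  have hsnd : Computable₂ fun _ y : List Bool => secondHalf y :=
    computable_secondHalf.comp Computable.snd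
  have hsum : Computable₂ fun _ y : List Bool => List.zipWith xor (firstHalf y) (secondHalf y) :=
    computable_zipWith_xor hfst hsnd
  have hfst' : Computable₂ fun p y : List Bool => List.zipWith xor p (firstHalf y) :=
    computable_zipWith_xor Computable.fst hfst
  have hsnd' : Computable₂ fun p y : List Bool => List.zipWith xor p (secondHalf y) :=
    computable_zipWith_xor Computable.fst hsnd
  rcases v with i | i <;> rcases v' with j | j <;> simp only [natDistK32]
  · split_ifs with h
    · exact h ▸ upperBound_self hU _
    · exact upperBound_two hU _ _
  · fin_cases j
    · fin_cases i
      · exact upperBound_append_left hU _ hfst fun s w => ⟨w 1 0, by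
          simp [vertexString, vertexBlocks]⟩
      · exact upperBound_append_left hU _ hsnd fun s w => ⟨w 1 1, by
          simp [vertexString, vertexBlocks]⟩
      · exact upperBound_append_left hU _ hsum fun s w => ⟨fun i => xor (w 1 0 i) (w 1 1 i), by
          simp [vertexString, vertexBlocks, zipWith_xor_ofFn]⟩
    · fin_cases i
      · exact upperBound_append_right hU _ hfst fun s w => ⟨w 0 0, by
          simp [vertexString, vertexBlocks]⟩
      · exact upperBound_append_right hU _ hsnd fun s w => ⟨w 0 1, by
          simp [vertexString, vertexBlocks]⟩
      · exact upperBound_append_right hU _ hsum fun s w => ⟨fun i => xor (w 0 0 i) (w 0 1 i), by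
          simp [vertexString, vertexBlocks, zipWith_xor_ofFn]⟩
  · fin_cases i
    · fin_cases j
      · exact upperBound_append_left hU _ hfst fun s w => ⟨w 0 1, by
          simp [vertexString, vertexBlocks]⟩
      · exact upperBound_append_right hU _ hfst fun s w => ⟨w 0 0, by
          simp [vertexString, vertexBlocks]⟩
      -- The xor column supplies the xor of the row's two blocks, so one block recovers the other.
      · exact upperBound_append_right hU _ hfst' fun s w => ⟨w 0 0, by
          simp [vertexString, vertexBlocks, zipWith_xor_ofFn]⟩
    · fin_cases j
      · exact upperBound_append_left hU _ hsnd fun s w => ⟨w 1 1, by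
          simp [vertexString, vertexBlocks]⟩
      · exact upperBound_append_right hU _ hsnd fun s w => ⟨w 1 0, by
          simp [vertexString, vertexBlocks]⟩
      · exact upperBound_append_right hU _ hsnd' fun s w => ⟨w 1 0, by
          simp [vertexString, vertexBlocks, zipWith_xor_ofFn]⟩
  · split_ifs with h
    · exact h ▸ upperBound_self hU _
    · exact upperBound_two hU _ _

/-! ### Lower bounds by counting -/

/-- Binary strings shorter than `m`. -/
theorem card_sigma_fin_bool (m : ℕ) :
    Fintype.card (Σ i : Fin m, (Fin i → Bool)) = 2 ^ m - 1 := by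
  simp [Fintype.card_sigma, Fin.sum_univ_eq_sum_range (fun i => 2 ^ i), Nat.geomSum_eq]

/-- Few data have a projection that is compressible relative to another projection. -/
theorem card_compressible_le {W Y R : Type*} [Fintype W] [Fintype Y] [Fintype R]
    (M : List Bool → List Bool →. List Bool) (m : ℕ) (x : W → List Bool) (y : W → Y)
    (str : Y → List Bool) (r : W → R)
    (hinj : ∀ w w', x w = x w' → y w = y w' → r w = r w' → w = w')
    (B : Finset W)
    (hB : ∀ w ∈ B, ∃ q : List Bool, x w ∈ M q (str (y w)) ∧ q.length < m) :
    B.card ≤ Fintype.card Y * Fintype.card R * 2 ^ m := by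
  choose! q hq hl using hB
  -- The short program and `y w` determine `x w`, as `M` is single-valued; with `r w` they determine
  -- `w`.
  let F : B → Y × R × (Σ i : Fin m, (Fin i → Bool)) := fun w =>
    (y w, r w, ⟨⟨(q w).length, hl w w.2⟩, (q w).get⟩)
  have hF : Function.Injective F := by
    intro w w' h
    simp only [F, Prod.mk.injEq] at h
    obtain ⟨h1, h2, h3⟩ := h
    have h4 : q w = q w' := by
      have := congrArg (fun t : (Σ i : Fin m, (Fin i → Bool)) => List.ofFn t.2) h3
      simpa using this
    have h5 := hq w w.2
    have h6 := hq w' w'.2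
    rw [← h4, ← h1] at h6
    exact Subtype.ext (hinj _ _ (Part.mem_unique h5 h6) h1 h2)
  have := Fintype.card_le_of_injective F hF
  rw [Fintype.card_coe, Fintype.card_prod, Fintype.card_prod, card_sigma_fin_bool] at this
  refine this.trans ?_
  rw [← mul_assoc]
  exact Nat.mul_le_mul_left _ (Nat.sub_le _ _)

/-- The data from which the five strings are built. -/
abbrev Blocks (s : ℕ) : Type := Fin 2 → Fin 2 → Fin s → Bool

theorem vertexString_injective {s : ℕ} {w w' : Blocks s} {v : Fin 3 ⊕ Fin 2}
    (h : vertexString w v = vertexString w' v) : vertexBlocks w v = vertexBlocks w' v := by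
  obtain ⟨h1, h2⟩ := List.append_inj h (by simp)
  exact Prod.ext (List.ofFn_injective h1) (List.ofFn_injective h2)

theorem blocks_ext {s : ℕ} {w w' : Blocks s} (h00 : w 0 0 = w' 0 0) (h01 : w 0 1 = w' 0 1)
    (h10 : w 1 0 = w' 1 0) (h11 : w 1 1 = w' 1 1) : w = w' := by
  funext i j
  fin_cases i <;> fin_cases j <;> assumption

theorem eq_right_of_xor_eq {s : ℕ} {a b a' b' : Fin s → Bool}
    (h : (fun i => xor (a i) (b i)) = fun i => xor (a' i) (b' i)) (ha : a = a') : b = b' := by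
  subst ha
  funext i
  simpa using congrFun h i

theorem eq_left_of_xor_eq {s : ℕ} {a b a' b' : Fin s → Bool}
    (h : (fun i => xor (a i) (b i)) = fun i => xor (a' i) (b' i)) (hb : b = b') : a = a' := by
  subst hb
  funext i
  simpa using congrFun h i

/-- Two vertices at distance `2` determine all blocks, and two vertices at distance `1` determine
them together with one more block. -/
theorem exists_determines {s : ℕ} (v v' : Fin 3 ⊕ Fin 2) (hv : v ≠ v') :
    ∃ r : Blocks s → Fin ((2 - natDistK32 v v') * s) → Bool, ∀ w w' : Blocks s,
      vertexBlocks w v = vertexBlocks w' v → vertexBlocks w v' = vertexBlocks w' v' →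
      r w = r w' → w = w' := by
  have one : ∀ f : Blocks s → Fin s → Bool, (∀ w w' : Blocks s,
      vertexBlocks w v = vertexBlocks w' v → vertexBlocks w v' = vertexBlocks w' v' →
        f w = f w' → w = w') → natDistK32 v v' = 1 →
      ∃ r : Blocks s → Fin ((2 - natDistK32 v v') * s) → Bool, ∀ w w' : Blocks s,
        vertexBlocks w v = vertexBlocks w' v → vertexBlocks w v' = vertexBlocks w' v' →
          r w = r w' → w = w' := by
    intro f hf h
    have e : (2 - natDistK32 v v') * s = s := by simp [h]
    refine ⟨fun w => f w ∘ Fin.cast e, fun w w' h1 h2 h3 => hf w w' h1 h2 ?_⟩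
    funext i
    simpa using congrFun h3 (Fin.cast e.symm i)
  rcases v with i | i <;> rcases v' with j | j
  · refine ⟨fun _ _ => false, fun w w' h1 h2 _ => ?_⟩
    fin_cases i <;> fin_cases j <;> simp [vertexBlocks] at h1 h2 hv <;>
      obtain ⟨h1, h1'⟩ := h1 <;> obtain ⟨h2, h2'⟩ := h2 <;> apply blocks_ext <;>
      first
      | assumption
      | exact eq_right_of_xor_eq h1 h2
      | exact eq_right_of_xor_eq h1' h2'
      | exact eq_left_of_xor_eq h1 h2
      | exact eq_left_of_xor_eq h1' h2'
      | exact eq_right_of_xor_eq h2 h1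
      | exact eq_right_of_xor_eq h2' h1'
      | exact eq_left_of_xor_eq h2 h1
      | exact eq_left_of_xor_eq h2' h1'
  -- Row `j` is known; the extra block is the entry of the other row that column `i` does not give.
  -- For the xor column either entry would do.
  · refine one (fun w => if j = 0 then (if i = 0 then w 1 1 else w 1 0) else
      (if i = 0 then w 0 1 else w 0 0)) ?_ rfl
    intro w w' h1 h2 h3
    fin_cases i <;> fin_cases j <;> simp [vertexBlocks] at h1 h2 h3 <;>
      obtain ⟨h1, h1'⟩ := h1 <;> obtain ⟨h2, h2'⟩ := h2 <;> apply blocks_ext <;>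
      first
      | assumption
      | exact eq_right_of_xor_eq h1 h3
      | exact eq_right_of_xor_eq h1' h3
  · refine one (fun w => if i = 0 then (if j = 0 then w 1 1 else w 1 0) else
      (if j = 0 then w 0 1 else w 0 0)) ?_ rfl
    intro w w' h2 h1 h3
    fin_cases i <;> fin_cases j <;> simp [vertexBlocks] at h1 h2 h3 <;>
      obtain ⟨h1, h1'⟩ := h1 <;> obtain ⟨h2, h2'⟩ := h2 <;> apply blocks_ext <;>
      first
      | assumption
      | exact eq_right_of_xor_eq h1 h3
      | exact eq_right_of_xor_eq h1' h3
  · refine ⟨fun _ _ => false, fun w w' h1 h2 _ => ?_⟩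
    fin_cases i <;> fin_cases j <;> simp [vertexBlocks] at h1 h2 hv <;>
      obtain ⟨h1, h1'⟩ := h1 <;> obtain ⟨h2, h2'⟩ := h2 <;> apply blocks_ext <;>
      assumption

theorem natDistK32_le (v v' : Fin 3 ⊕ Fin 2) : natDistK32 v v' ≤ 2 := by
  revert v v'; decide

theorem natDistK32_self (v : Fin 3 ⊕ Fin 2) : natDistK32 v v = 0 := by
  revert v; decide

open Classical in
/-- The choices of blocks for which one vertex is compressible given another. -/
noncomputable def compressible (U : List Bool → List Bool →. List Bool) (s : ℕ)
    (v v' : Fin 3 ⊕ Fin 2) : Finset (Blocks s) :=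
  {w | ∃ q : List Bool, vertexString w v ∈ U q (vertexString w v') ∧
    q.length < s * natDistK32 v v' - 5}

/-- With `d` the graph distance, the count is `2 ^ (2s) * 2 ^ ((2 - d)s) * 2 ^ (sd - 5) = 2 ^ (4s -
5)`, out of `2 ^ (4s)` matrices. -/
theorem card_compressible (U : List Bool → List Bool →. List Bool) (s : ℕ)
    (v v' : Fin 3 ⊕ Fin 2) : 32 * (compressible U s v v').card ≤ Fintype.card (Blocks s) := by
  classical
  -- Here truncated subtraction makes the length threshold `0`, so nothing is compressible. This
  -- also covers `v = v'`.
  by_cases hs : s * natDistK32 v v' < 5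
  · have : compressible U s v v' = ∅ := by
      simp [compressible, Nat.sub_eq_zero_of_le hs.le]
    simp [this]
  have hv : v ≠ v' := by
    rintro rfl
    simp [natDistK32_self] at hs
  obtain ⟨r, hr⟩ := exists_determines (s := s) v v' hv
  have h := card_compressible_le U (s * natDistK32 v v' - 5) (fun w => vertexString w v)
    (fun w => vertexBlocks w v') (fun b => List.ofFn b.1 ++ List.ofFn b.2) r
    (fun w w' h1 h2 h3 => hr w w' (vertexString_injective h1) h2 h3)
    (compressible U s v v') (fun w hw => (Finset.mem_filter.1 hw).2)
  have hd := natDistK32_le v v'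
  simp only [Fintype.card_prod, Fintype.card_pi, Fintype.card_bool, Finset.prod_const,
    Finset.card_univ, Fintype.card_fin] at h ⊢
  calc 32 * (compressible U s v v').card
      ≤ 2 ^ 5 * (2 ^ s * 2 ^ s * 2 ^ ((2 - natDistK32 v v') * s) *
          2 ^ (s * natDistK32 v v' - 5)) := by
        norm_num only at *; omega
    _ = ((2 ^ s) ^ 2) ^ 2 := by
        simp only [← pow_add, ← pow_mul]
        congr 1
        generalize natDistK32 v v' = d at *
        interval_cases d <;> omega

/-- Blocks can be chosen so that all five strings are incompressible given any other. -/
theorem exists_incompressible {U : List Bool → List Bool →. List Bool}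
    (hU : IsOptimalPrefixMachine U) (s : ℕ) :
    ∃ w : Blocks s, ∀ v v' : Fin 3 ⊕ Fin 2,
      s * natDistK32 v v' ≤ condK U (vertexString w v) (vertexString w v') + 5 := by
  classical
  -- Each of the `25` ordered pairs excludes at most `1/32` of the matrices; this is why the slack
  -- is `5` bits.
  have hlt : ((Finset.univ : Finset ((Fin 3 ⊕ Fin 2) × (Fin 3 ⊕ Fin 2))).biUnion
      fun a => compressible U s a.1 a.2).card < (Finset.univ : Finset (Blocks s)).card := by
    have h1 := Finset.card_biUnion_le (s := Finset.univ)
      (t := fun a : (Fin 3 ⊕ Fin 2) × (Fin 3 ⊕ Fin 2) => compressible U s a.1 a.2)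
    have h2 := Finset.sum_le_sum fun (a : (Fin 3 ⊕ Fin 2) × (Fin 3 ⊕ Fin 2))
      (_ : a ∈ Finset.univ) => card_compressible U s a.1 a.2
    rw [← Finset.mul_sum] at h2
    simp only [Finset.sum_const, Finset.card_univ, Fintype.card_prod, Fintype.card_sum,
      Fintype.card_fin, smul_eq_mul] at h2
    have h3 : 0 < Fintype.card (Blocks s) := Fintype.card_pos
    rw [Finset.card_univ]
    omega
  obtain ⟨w, -, hw⟩ := Finset.exists_mem_notMem_of_card_lt_card hlt
  refine ⟨w, fun v v' => ?_⟩
  by_contra hcon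
  obtain ⟨q, hq, hl⟩ := hU.exists_program (vertexString w v) (vertexString w v')
  refine hw (Finset.mem_biUnion.2 ⟨(v, v'), Finset.mem_univ _, ?_⟩)
  simp only [compressible, Finset.mem_filter, Finset.mem_univ, true_and]
  exact ⟨q, hq, by omega⟩

theorem natDistK32_comm (v v' : Fin 3 ⊕ Fin 2) : natDistK32 v v' = natDistK32 v' v := by
  revert v v'; decide

/-- The distances of suitable strings agree with the scaled graph metric up to a constant. -/
theorem exists_scaleEmbedding {U : List Bool → List Bool →. List Bool}
    (hU : IsOptimalPrefixMachine U) {c : ℝ} (hc : 0 ≤ c) :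
    ∃ φ : ℕ → Fin 3 ⊕ Fin 2 → List Bool, ∃ b : ℝ, ∀ (s : ℕ) (v v' : Fin 3 ⊕ Fin 2),
      |dK U c (φ s v) (φ s v') - s * distK32 v v'| ≤ b := by
  choose k hk using exists_upperBound hU
  choose w hw using exists_incompressible hU
  refine ⟨fun s => vertexString (w s),
    (∑ a : (Fin 3 ⊕ Fin 2) × (Fin 3 ⊕ Fin 2), k a.1 a.2 : ℕ) + 5 + c, fun s v v' => ?_⟩
  have hle : ∀ u u', k u u' ≤ ∑ a : (Fin 3 ⊕ Fin 2) × (Fin 3 ⊕ Fin 2), k a.1 a.2 := fun u u' =>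
    Finset.single_le_sum (f := fun a : (Fin 3 ⊕ Fin 2) × (Fin 3 ⊕ Fin 2) => k a.1 a.2)
      (fun _ _ => Nat.zero_le _) (Finset.mem_univ (u, u'))
  generalize (∑ a : (Fin 3 ⊕ Fin 2) × (Fin 3 ⊕ Fin 2), k a.1 a.2) = b at *
  have key : ∀ u u', (s * natDistK32 u u' : ℝ) ≤
      condK U (vertexString (w s) u) (vertexString (w s) u') + 5 ∧
      (condK U (vertexString (w s) u) (vertexString (w s) u') : ℝ) ≤ s * natDistK32 u u' + b :=
    fun u u' => ⟨by exact_mod_cast hw s u u',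
      by exact_mod_cast (hk u u' s (w s)).trans (Nat.add_le_add_left (hle u u') _)⟩
  have hb : (0 : ℝ) ≤ b := Nat.cast_nonneg b
  have hd : (0 : ℝ) ≤ s * natDistK32 v v' := by positivity
  obtain ⟨h1, h2⟩ := key v v'
  obtain ⟨h3, h4⟩ := key v' v
  rw [natDistK32_comm v' v] at h3 h4
  rw [distK32_eq, abs_le]
  unfold dK
  split_ifs with heq
  -- If two strings coincide, their conditional complexity is bounded, so the lower bound forces `s
  -- * d` to be bounded as well.
  · have h5 : (condK U (vertexString (w s) v) (vertexString (w s) v') : ℝ) ≤ b := by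
      have := (key v v).2
      rw [natDistK32_self] at this
      have heq' : vertexString (w s) v = vertexString (w s) v' := heq
      rw [← heq']
      simpa using this
    constructor <;> linarith
  · have := le_max_left (condK U (vertexString (w s) v) (vertexString (w s) v') : ℝ)
      (condK U (vertexString (w s) v') (vertexString (w s) v))
    have := max_le h2 h4
    constructor <;> linarith

/-! ### The graph `K_{3,2}` is not approximately embeddable into `ℓ_p` for `1 ≤ p < ∞` -/

/-- The pentagonal inequality on the real line. -/
theorem pentagonal_abs (a b c x y : ℝ) :
    |a - b| + |a - c| + |b - c| + |x - y| ≤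
      |a - x| + |a - y| + |b - x| + |b - y| + |c - x| + |c - y| := by
  grind (splits := 12)

/-- The `ℓ_1` norm is the sum of the coordinate absolute values, so the inequality on the line can
be summed. -/
theorem lp_one_pentagonal (a b c x y : lp (fun _ : ℕ => ℝ) 1) :
    ‖a - b‖ + ‖a - c‖ + ‖b - c‖ + ‖x - y‖ ≤
      ‖a - x‖ + ‖a - y‖ + ‖b - x‖ + ‖b - y‖ + ‖c - x‖ + ‖c - y‖ := by
  have h : ∀ u v : lp (fun _ : ℕ => ℝ) 1, HasSum (fun i => |u i - v i|) ‖u - v‖ := fun u v => by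
    simpa using lp.hasSum_norm (p := 1) (by simp) (u - v)
  exact hasSum_le (fun i => pentagonal_abs (a i) (b i) (c i) (x i) (y i))
    ((((h a b).add (h a c)).add (h b c)).add (h x y))
    ((((((h a x).add (h a y)).add (h b x)).add (h b y)).add (h c x)).add (h c y))

/-- Strict midpoint convexity of `|·| ^ p`. -/
theorem abs_midpoint_rpow_lt {p : ℝ} (hp : 1 < p) {a b : ℝ} (h : a ≠ b) :
    |(a + b) / 2| ^ p < (|a| ^ p + |b| ^ p) / 2 := by
  by_cases hab : |a| = |b|
  · have : a + b = 0 := by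
      rcases abs_eq_abs.1 hab with h' | h'
      · exact absurd h' h
      · linarith
    have hb : b ≠ 0 := by
      rintro rfl
      simp at hab
      exact h hab
    rw [this, hab]
    have : 0 < |b| ^ p := Real.rpow_pos_of_pos (abs_pos.2 hb) p
    simp [Real.zero_rpow (by linarith : p ≠ 0), this]
  · have h1 := And.right (strictConvexOn_rpow hp) (abs_nonneg a) (abs_nonneg b) hab
      (one_half_pos (α := ℝ)) one_half_pos (by norm_num)
    simp only [smul_eq_mul] at h1
    have h2 : |(a + b) / 2| ≤ 1 / 2 * |a| + 1 / 2 * |b| := by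
      rw [abs_div, abs_two]
      linarith [abs_add_le a b]
    have := Real.rpow_le_rpow (abs_nonneg _) h2 (by linarith : 0 ≤ p)
    linarith

/-- A pointwise form of uniform convexity. -/
theorem exists_abs_sub_rpow_le {p : ℝ} (hp : 1 < p) {ε : ℝ} (hε : 0 < ε) :
    ∃ C : ℝ, 0 ≤ C ∧ ∀ a b : ℝ, |a - b| ^ p ≤ ε * (|a| ^ p + |b| ^ p) +
      C * ((|a| ^ p + |b| ^ p) / 2 - |(a + b) / 2| ^ p) := by
  have hp0 : 0 < p := by linarith
  have hc : Continuous fun t : ℝ => |t| ^ p := continuous_abs.rpow_const fun _ => .inr hp0.le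
  let N : ℝ × ℝ → ℝ := fun z => |z.1| ^ p + |z.2| ^ p
  let D : ℝ × ℝ → ℝ := fun z => |z.1 - z.2| ^ p
  let G : ℝ × ℝ → ℝ := fun z => N z / 2 - |(z.1 + z.2) / 2| ^ p
  have hN : Continuous N := (hc.comp continuous_fst).add (hc.comp continuous_snd)
  have hD : Continuous D := hc.comp (continuous_fst.sub continuous_snd)
  have hG : Continuous G :=
    (hN.div_const 2).sub (hc.comp ((continuous_fst.add continuous_snd).div_const 2))
  have hGnn : ∀ z, 0 ≤ G z := fun z => by
    by_cases h : z.1 = z.2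
    · have : (z.2 + z.2) / 2 = z.2 := by ring
      simp [G, N, h, this]
    · exact (sub_pos.2 (abs_midpoint_rpow_lt hp h)).le
  -- a bound on the unit sphere
  have hS : ∃ C : ℝ, 0 ≤ C ∧ ∀ z ∈ Metric.sphere (0 : ℝ × ℝ) 1, D z ≤ ε * N z + C * G z := by
    -- Off `K` the term `ε * N` suffices. On `K` strict convexity gives `G > 0`, since on the
    -- diagonal `D = 0 < N`; compactness then bounds `D / G`.
    let K : Set (ℝ × ℝ) := Metric.sphere 0 1 ∩ {z | ε * N z ≤ D z}
    have hK : IsCompact K :=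
      (isCompact_sphere 0 1).inter_right (isClosed_le (continuous_const.mul hN) hD)
    have hGK : ∀ z ∈ K, G z ≠ 0 := by
      rintro z ⟨hz, hz'⟩
      refine (sub_pos.2 (abs_midpoint_rpow_lt hp fun h => ?_)).ne'
      have hD0 : D z = 0 := by simp [D, h, Real.zero_rpow hp0.ne']
      have hN0 : N z ≤ 0 := by
        have : ε * N z ≤ 0 := hD0 ▸ hz'
        by_contra hcon
        exact absurd (mul_pos hε (not_le.1 hcon)) (not_lt.2 this)
      have h2 : |z.2| ^ p ≤ 0 := by
        have : N z = 2 * |z.2| ^ p := by simp only [N, h]; ring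
        linarith
      have h3 : z.2 = 0 := by
        by_contra hne
        exact absurd (Real.rpow_pos_of_pos (abs_pos.2 hne) p) (not_lt.2 h2)
      have : z = 0 := Prod.ext (h.trans h3) h3
      simp [this] at hz
    obtain ⟨C, hC⟩ := hK.exists_bound_of_continuousOn (f := fun z => D z / G z)
      (hD.continuousOn.div hG.continuousOn hGK)
    refine ⟨max C 0, le_max_right _ _, fun z hz => ?_⟩
    have hNz : 0 ≤ ε * N z := by positivity
    by_cases h : ε * N z ≤ D z
    · have hpos : 0 < G z := lt_of_le_of_ne (hGnn z) (hGK z ⟨hz, h⟩).symm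
      have := (le_abs_self _).trans ((hC z ⟨hz, h⟩).trans (le_max_left C 0))
      rw [div_le_iff₀ hpos] at this
      linarith
    · have := mul_nonneg (le_max_right C 0) (hGnn z)
      linarith
  obtain ⟨C, hC0, hC⟩ := hS
  refine ⟨C, hC0, fun a b => ?_⟩
  by_cases h0 : ((a, b) : ℝ × ℝ) = 0
  · obtain ⟨rfl, rfl⟩ := Prod.mk.inj h0
    simp [Real.zero_rpow hp0.ne']
  have hr : 0 < ‖((a, b) : ℝ × ℝ)‖ := norm_pos_iff.2 h0
  -- Both sides are homogeneous of degree `p`, so the unit sphere suffices.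
  have := hC (‖((a, b) : ℝ × ℝ)‖⁻¹ • (a, b)) (by
    rw [mem_sphere_zero_iff_norm, norm_smul, norm_inv, norm_norm, inv_mul_cancel₀ hr.ne'])
  set r := ‖((a, b) : ℝ × ℝ)‖⁻¹
  have hr' : 0 < r := inv_pos.2 hr
  have hmul : ∀ t : ℝ, |r * t| ^ p = r ^ p * |t| ^ p := fun t => by
    rw [abs_mul, abs_of_pos hr', Real.mul_rpow hr'.le (abs_nonneg t)]
  have e1 : r * a + r * b = r * (a + b) := by ring
  simp only [D, N, G, Prod.smul_fst, Prod.smul_snd, smul_eq_mul, ← mul_sub, e1, mul_div_assoc,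
    hmul] at this
  have hrp : 0 < r ^ p := Real.rpow_pos_of_pos hr' p
  refine le_of_mul_le_mul_left (this.trans_eq ?_) hrp
  ring

/-- Uniform convexity of `ℓ_p` for `1 < p < ∞`. -/
theorem exists_lp_norm_sub_rpow_le {p : ENNReal} [Fact (1 ≤ p)] (hp : 1 < p.toReal) {ε : ℝ}
    (hε : 0 < ε) :
    ∃ C : ℝ, 0 ≤ C ∧ ∀ u v : lp (fun _ : ℕ => ℝ) p, ‖u - v‖ ^ p.toReal ≤
      ε * (‖u‖ ^ p.toReal + ‖v‖ ^ p.toReal) +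
      C * ((‖u‖ ^ p.toReal + ‖v‖ ^ p.toReal) / 2 - (‖u + v‖ / 2) ^ p.toReal) := by
  obtain ⟨C, hC0, hC⟩ := exists_abs_sub_rpow_le hp hε
  refine ⟨C, hC0, fun u v => ?_⟩
  have hp0 : 0 < p.toReal := by linarith
  have h := lp.hasSum_norm (E := fun _ : ℕ => ℝ) hp0
  have hm : HasSum (fun i => |(u i + v i) / 2| ^ p.toReal) ((‖u + v‖ / 2) ^ p.toReal) := by
    rw [Real.div_rpow (norm_nonneg _) (by norm_num)]
    refine ((h (u + v)).div_const _).congr_fun ?_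
    intro i
    simp [abs_div, Real.div_rpow]
  exact hasSum_le (fun i => hC (u i) (v i)) (h (u - v))
    ((((h u).add (h v)).mul_left ε).add (((((h u).add (h v)).div_const 2).sub hm).mul_left C))

/-- Approximate midpoints in `ℓ_p` are close to the midpoint. -/
theorem exists_lp_near_midpoint {p : ENNReal} [Fact (1 ≤ p)] (hp : 1 < p.toReal) :
    ∃ η : ℝ, 0 < η ∧ η ≤ 1 / 10 ∧ ∀ u v : lp (fun _ : ℕ => ℝ) p, ‖u‖ ≤ 1 + η → ‖v‖ ≤ 1 + η →
      2 - η ≤ ‖u + v‖ → ‖u - v‖ < 1 := by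
  have hp0 : 0 < p.toReal := by linarith
  obtain ⟨C, hC0, hC⟩ := exists_lp_norm_sub_rpow_le hp (ε := 1 / 4) (by norm_num)
  have hcont : Continuous fun η : ℝ => 1 / 4 * ((1 + η) ^ p.toReal + (1 + η) ^ p.toReal) +
      C * (((1 + η) ^ p.toReal + (1 + η) ^ p.toReal) / 2 - ((2 - η) / 2) ^ p.toReal) := by
    have h1 : Continuous fun η : ℝ => (1 + η) ^ p.toReal :=
      (continuous_const.add continuous_id).rpow_const fun _ => .inr hp0.le
    have h2 : Continuous fun η : ℝ => ((2 - η) / 2) ^ p.toReal :=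
      ((continuous_const.sub continuous_id).div_const 2).rpow_const fun _ => .inr hp0.le
    fun_prop
  -- At `η = 0` the `C` term vanishes and the bound is `2 * (1 / 4) < 1`.
  have hev := (hcont.tendsto 0).eventually_lt_const (u := 1) (by norm_num)
  obtain ⟨δ, hδ, hδ'⟩ := Metric.eventually_nhds_iff.1 hev
  refine ⟨min (δ / 2) (1 / 10), by positivity, min_le_right _ _, fun u v hu hv huv => ?_⟩
  have hη : 0 < min (δ / 2) (1 / 10 : ℝ) := by positivity
  have hη1 : min (δ / 2) (1 / 10 : ℝ) ≤ 1 / 10 := min_le_right _ _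
  have hlt := hδ' (y := min (δ / 2) (1 / 10)) (by
    rw [Real.dist_0_eq_abs, abs_of_pos hη]
    linarith [min_le_left (δ / 2) (1 / 10 : ℝ)])
  generalize min (δ / 2) (1 / 10 : ℝ) = η at *
  have hu' := Real.rpow_le_rpow (norm_nonneg u) hu hp0.le
  have hv' := Real.rpow_le_rpow (norm_nonneg v) hv hp0.le
  have huv' := Real.rpow_le_rpow (by linarith) (div_le_div_of_nonneg_right huv zero_le_two) hp0.le
  have h : ‖u - v‖ ^ p.toReal < 1 := by
    refine ((hC u v).trans ?_).trans_lt hlt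
    gcongr
  by_contra hcon
  exact absurd (Real.one_le_rpow (not_lt.1 hcon) hp0.le) (not_le.2 h)

/-- For `1 ≤ p ≤ 2` no five points of `ℓ_p` have distances close to those of `K_{3,2}`. -/
theorem exists_lp_far_from_distK32 {p : ENNReal} (hp : 1 ≤ p) (hp2 : p ≤ 2) :
    ∃ η : ℝ, 0 < η ∧ ∀ f : Fin 3 ⊕ Fin 2 → lp (fun _ : ℕ => ℝ) p,
      ¬ ∀ v v', |‖f v - f v'‖ - distK32 v v'| ≤ η := by
  rcases hp.eq_or_lt with rfl | hp1
  -- Ten distances with error `1 / 10` change the inequality by at most `1`, less than the gap `8 -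
  -- 6`.
  · refine ⟨1 / 10, by norm_num, fun f hf => ?_⟩
    have h := lp_one_pentagonal (f (.inl 0)) (f (.inl 1)) (f (.inl 2)) (f (.inr 0)) (f (.inr 1))
    have g := fun v v' => abs_le.1 (hf v v')
    simp only [distK32_eq] at g
    have g1 := (g (.inl 0) (.inl 1)).1
    have g2 := (g (.inl 0) (.inl 2)).1
    have g3 := (g (.inl 1) (.inl 2)).1
    have g4 := (g (.inr 0) (.inr 1)).1
    have g5 := (g (.inl 0) (.inr 0)).2
    have g6 := (g (.inl 0) (.inr 1)).2
    have g7 := (g (.inl 1) (.inr 0)).2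
    have g8 := (g (.inl 1) (.inr 1)).2
    have g9 := (g (.inl 2) (.inr 0)).2
    have g10 := (g (.inl 2) (.inr 1)).2
    simp [natDistK32] at g1 g2 g3 g4 g5 g6 g7 g8 g9 g10
    linarith
  · have : Fact (1 ≤ p) := ⟨hp⟩
    have hpr : 1 < p.toReal := by
      have hne : p ≠ ⊤ := ne_top_of_le_ne_top (by simp) hp2
      simpa using (ENNReal.toReal_lt_toReal (by simp) hne).2 hp1
    obtain ⟨η, hη, hη1, h⟩ := exists_lp_near_midpoint hpr
    refine ⟨η, hη, fun f hf => ?_⟩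
    have g := fun v v' => abs_le.1 (hf v v')
    simp only [distK32_eq] at g
    -- The vector is twice the displacement of `f (.inr j)` from the midpoint of `f (.inl 0)` and `f
    -- (.inl 1)`. The two such vectors differ by `2 • (f (.inr 0) - f (.inr 1))`, of norm close to
    -- `4`.
    have key : ∀ j : Fin 2, ‖(f (.inr j) - f (.inl 0)) - (f (.inl 1) - f (.inr j))‖ < 1 := by
      intro j
      have g1 := (g (.inr j) (.inl 0)).2
      have g2 := (g (.inl 1) (.inr j)).2
      have g3 := (g (.inl 1) (.inl 0)).1
      simp [natDistK32] at g1 g2 g3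
      refine h _ _ (by linarith) (by linarith) ?_
      rw [show f (.inr j) - f (.inl 0) + (f (.inl 1) - f (.inr j)) = f (.inl 1) - f (.inl 0) by
        abel]
      linarith
    have g4 := (g (.inr 0) (.inr 1)).1
    simp [natDistK32] at g4
    have h1 := norm_sub_le ((f (.inr 0) - f (.inl 0)) - (f (.inl 1) - f (.inr 0)))
      ((f (.inr 1) - f (.inl 0)) - (f (.inl 1) - f (.inr 1)))
    rw [show (f (.inr 0) - f (.inl 0)) - (f (.inl 1) - f (.inr 0)) -
      ((f (.inr 1) - f (.inl 0)) - (f (.inl 1) - f (.inr 1))) =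
      (2 : ℝ) • (f (.inr 0) - f (.inr 1)) by rw [two_smul]; abel, norm_smul] at h1
    have h2 := key 0
    have h3 := key 1
    norm_num at h1
    linarith

theorem mainTheorem12 (U : List Bool → List Bool →. List Bool) (hU : IsOptimalPrefixMachine U)
    (c : ℝ) (hc : 0 ≤ c) :
    (∀ p : ENNReal, 1 ≤ p → p ≤ 2 → ¬ IsoEmbedsIntoLp (dK U c) p) ∧
    (∃ φ : ℕ → Fin 3 ⊕ Fin 2 → List Bool, IsScaleEmbedding distK32 (dK U c) φ) ∧
    (∀ p : ENNReal, 1 ≤ p → p ≤ 2 → ¬ IsoEmbedsIntoLp distK32 p) := by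
  obtain ⟨φ, b, hφ⟩ := exists_scaleEmbedding hU hc
  refine ⟨fun p hp hp2 => ?_, ⟨φ, 0, b, fun s _ v v' => by simpa using hφ s v v'⟩,
    fun p hp hp2 => ?_⟩
  · rintro ⟨f, hf⟩
    have : Fact (1 ≤ p) := ⟨hp⟩
    obtain ⟨η, hη, h⟩ := exists_lp_far_from_distK32 hp hp2
    -- For this `s` the additive error `b`, divided by `s`, is below `η`.
    obtain ⟨s, hs⟩ := exists_nat_gt (b / η)
    have hb : 0 ≤ b := (abs_nonneg _).trans (hφ 0 (.inl 0) (.inl 0))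
    have hs0 : (0 : ℝ) < s := (div_nonneg hb hη.le).trans_lt hs
    rw [div_lt_iff₀ hη] at hs
    refine h (fun v => (s : ℝ)⁻¹ • f (φ s v)) fun v v' => ?_
    rw [← smul_sub, norm_smul, hf, norm_inv, Real.norm_of_nonneg hs0.le]
    refine le_of_mul_le_mul_left ?_ hs0
    rw [← abs_of_pos hs0, ← abs_mul, abs_of_pos hs0, mul_sub, mul_inv_cancel_left₀ hs0.ne']
    exact (hφ s v v').trans hs.le
  · rintro ⟨f, hf⟩
    obtain ⟨η, hη, h⟩ := exists_lp_far_from_distK32 hp hp2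
    exact h f fun v v' => by simpa [hf] using hη.le
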